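/- Let $\Omega=\Omega_0\cup\Omega_1\cup\Omega_2$ be a set of nullary, unary and binary operation symbols with $\Omega_0=\{0\}$, $-\in\Omega_1$, $+\in\Omega_2$, and put $\Omega_1'=\Omega_1\setminus\{-\}$, $\Omega_2'=\Omega_2\setminus\{+\}$. Let $E$ be a set of identities in these operations which includes - the group laws for $0,-,+$ (the group is not assumed to be commutative); - for each $\star\in\Omega_2'$, the identity $a\star^{\circ}b=b\star a$ for some $\star^{\circ}\in\Omega_2'$; - $a\star(b+c)=a\star b+a\star c$ for each $\star\in\Omega_2'$; - $\omega(a+b)=\omega(a)+\omega(b)$ and $\omega(a)\star b=\omega(a\star b)$ for each $\omega\in\Omega_1'$ and $\star\in\Omega_2'$. A *topological group with operations* (for $(\Omega,E)$) is a topological space with a continuous operation for each symbol of $\Omega$ such that all identities in $E$ hold; a *morphism* is a continuous map that preserves all operations in $\Omega$. If $X$ is a topological group with operations, then $\pi_1(X,0)$ carries the operations of $\Omega$ that are induced by the pointwise operations on loops, $[\alpha]\star[\beta]=[\alpha\star\beta]$ for $\star\in\Omega_2$ and $\omega[\alpha]=[\omega\alpha]$ for $\omega\in\Omega_1$; a *subobject*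 of $\pi_1(X,0)$ is a subset closed under all operations in $\Omega$. The *characteristic group* of a covering map $p\colon(\widetilde X,\tilde 0)\to(X,0)$ is the subgroup $p_\star(\pi_1(\widetilde X,\tilde 0))$ of $\pi_1(X,0)$. A space $X$ is *semi-locally simply connected* if each point has an open path connected neighbourhood $U$ such that for all $x\in U$ the homomorphism $\pi_1(U,x)\to\pi_1(X,x)$ induced by the inclusion is trivial. **Theorem.** Let $X$ be a topological group with operations whose underlying space is connected, locally path connected and semi-locally simply connected. Let $p\colon(\widetilde X,\tilde 0)\to(X,0)$ be a covering map such that $\widetilde X$ is path connected and the characteristic group of $p$ is a subobject of $\pi_1(X,0)$. Then the operations of $X$ lift to $\widetilde X$: there are operations on $\widetilde X$ which make it a topological group with operations for the same $(\Omega,E)$ such that $\tilde 0$ is its identity element $0$ and $p$ is a morphism of topological groups with operations. -/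

import Mathlib

namespace GroupWithOps

universe u v w

/-! ### Groups with operations -/

/-- The operation symbols of groups with operations, indexed by their arity:
`Ω₀ = {0}`, `Ω₁ = {-} ∪ Ω₁'`, `Ω₂ = {+} ∪ Ω₂'`, and there are no symbols of other arities.
Here `Un` is `Ω₁'` and `Bin` is `Ω₂'`. -/
inductive OpSymbol (Un : Type u) (Bin : Type v) : ℕ → Type (max u v)
  | zero : OpSymbol Un Bin 0
  | neg : OpSymbol Un Bin 1
  | add : OpSymbol Un Bin 2
  | unary (o : Un) : OpSymbol Un Bin 1
  | binary (b : Bin) : OpSymbol Un Bin 2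

/-- The algebraic language `Ω` with the given `Ω₁'` and `Ω₂'`. -/
def opLanguage (Un : Type u) (Bin : Type v) : FirstOrder.Language.{max u v, 0} where
  Functions := OpSymbol Un Bin
  Relations := fun _ => Empty

/-- Terms in the operations of `Ω`, in variables indexed by `ℕ`. -/
abbrev OpTerm (Un : Type u) (Bin : Type v) : Type (max u v) :=
  (opLanguage Un Bin).Term ℕ

namespace OpTerm

variable {Un : Type u} {Bin : Type v}

/-- The `i`-th variable. -/
def X (i : ℕ) : OpTerm Un Bin := FirstOrder.Language.Term.var i

/-- The term `0`. -/
def zero : OpTerm Un Bin :=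
  FirstOrder.Language.Term.func (L := opLanguage Un Bin) (l := 0) OpSymbol.zero ![]

/-- The term `-s`. -/
def neg (s : OpTerm Un Bin) : OpTerm Un Bin :=
  FirstOrder.Language.Term.func (L := opLanguage Un Bin) (l := 1) OpSymbol.neg ![s]

/-- The term `s + t`. -/
def add (s t : OpTerm Un Bin) : OpTerm Un Bin :=
  FirstOrder.Language.Term.func (L := opLanguage Un Bin) (l := 2) OpSymbol.add ![s, t]

/-- The term `ω(s)`, for `ω ∈ Ω₁'`. -/
def un (o : Un) (s : OpTerm Un Bin) : OpTerm Un Bin :=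
  FirstOrder.Language.Term.func (L := opLanguage Un Bin) (l := 1) (OpSymbol.unary o) ![s]

/-- The term `s ⋆ t`, for `⋆ ∈ Ω₂'`. -/
def bin (b : Bin) (s t : OpTerm Un Bin) : OpTerm Un Bin :=
  FirstOrder.Language.Term.func (L := opLanguage Un Bin) (l := 2) (OpSymbol.binary b) ![s, t]

end OpTerm

/-- The data `(Ω, E)` which define a category of groups with operations: the sets `Ω₁'` and `Ω₂'`
of the unary operations other than `-` and the binary operations other than `+`, and a set `E` of
identities (pairs of terms) that includes the group laws and the identities required of the
further operations. The set `E` may contain any other identities. -/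
structure OpTheory where
  /-- The set `Ω₁'`. -/
  Un : Type u
  /-- The set `Ω₂'`. -/
  Bin : Type v
  /-- The set `E` of identities. -/
  E : Set (OpTerm Un Bin × OpTerm Un Bin)
  add_assoc_mem :
    ((OpTerm.X 0).add (OpTerm.X 1) |>.add (OpTerm.X 2),
      (OpTerm.X 0).add ((OpTerm.X 1).add (OpTerm.X 2))) ∈ E
  zero_add_mem : (OpTerm.zero.add (OpTerm.X 0), OpTerm.X 0) ∈ E
  add_zero_mem : ((OpTerm.X 0).add OpTerm.zero, OpTerm.X 0) ∈ E
  neg_add_mem : ((OpTerm.X 0).neg.add (OpTerm.X 0), OpTerm.zero) ∈ E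
  add_neg_mem : ((OpTerm.X 0).add (OpTerm.X 0).neg, OpTerm.zero) ∈ E
  /-- Each `⋆ ∈ Ω₂'` has an opposite `⋆° ∈ Ω₂'`, where `a ⋆° b = b ⋆ a`. -/
  opp_mem : ∀ b : Bin, ∃ b' : Bin,
    (OpTerm.bin b' (OpTerm.X 0) (OpTerm.X 1), OpTerm.bin b (OpTerm.X 1) (OpTerm.X 0)) ∈ E
  /-- `a ⋆ (b + c) = a ⋆ b + a ⋆ c`. -/
  bin_add_mem : ∀ b : Bin,
    (OpTerm.bin b (OpTerm.X 0) ((OpTerm.X 1).add (OpTerm.X 2)),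
      (OpTerm.bin b (OpTerm.X 0) (OpTerm.X 1)).add (OpTerm.bin b (OpTerm.X 0) (OpTerm.X 2))) ∈ E
  /-- `ω(a + b) = ω(a) + ω(b)`. -/
  un_add_mem : ∀ o : Un,
    (OpTerm.un o ((OpTerm.X 0).add (OpTerm.X 1)),
      (OpTerm.un o (OpTerm.X 0)).add (OpTerm.un o (OpTerm.X 1))) ∈ E
  /-- `ω(a) ⋆ b = ω(a ⋆ b)`. -/
  un_bin_mem : ∀ (o : Un) (b : Bin),
    (OpTerm.bin b (OpTerm.un o (OpTerm.X 0)) (OpTerm.X 1),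
      OpTerm.un o (OpTerm.bin b (OpTerm.X 0) (OpTerm.X 1))) ∈ E

/-- The language of the theory `T`. -/
abbrev OpTheory.lang (T : OpTheory.{u, v}) : FirstOrder.Language.{max u v, 0} := opLanguage T.Un T.Bin

/-- Topological groups with operations for the theory `T`: a topological space with an
interpretation of every symbol of `Ω` (the group operations `0`, `-`, `+` included) by a continuous
operation, such that all identities in `E` (the group laws included) hold. These are the objects
of the category `TC` determined by `T`. -/
class TopGroupWithOps (T : OpTheory.{u, v}) (X : Type w) [TopologicalSpace X] extends
    T.lang.Structure X where
  continuous_op : ∀ {n : ℕ} (s : T.lang.Functions n),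
    Continuous (fun x : Fin n → X => FirstOrder.Language.Structure.funMap s x)
  identity : ∀ e ∈ T.E, ∀ a : ℕ → X, e.1.realize a = e.2.realize a

section Zero

variable (T : OpTheory.{u, v}) (X : Type w) [TopologicalSpace X] [TopGroupWithOps T X]

/-- The group identity `0` of a topological group with operations. -/
def zero : X := FirstOrder.Language.Structure.funMap (L := T.lang) (n := 0) OpSymbol.zero ![]

/-- The operation `-` of a topological group with operations. -/
def neg (x : X) : X := FirstOrder.Language.Structure.funMap (L := T.lang) (n := 1) OpSymbol.neg ![x]

/-- The operation `+` of a topological group with operations. -/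
def add (x y : X) : X :=
  FirstOrder.Language.Structure.funMap (L := T.lang) (n := 2) OpSymbol.add ![x, y]

/-- The operation `ω ∈ Ω₁'` of a topological group with operations. -/
def un (o : T.Un) (x : X) : X :=
  FirstOrder.Language.Structure.funMap (L := T.lang) (n := 1) (OpSymbol.unary o) ![x]

/-- The operation `⋆ ∈ Ω₂'` of a topological group with operations. -/
def bin (b : T.Bin) (x y : X) : X :=
  FirstOrder.Language.Structure.funMap (L := T.lang) (n := 2) (OpSymbol.binary b) ![x, y]

variable {T X} (a : ℕ → X)

theorem realize_zero : (OpTerm.zero : OpTerm T.Un T.Bin).realize a = zero T X :=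
  congrArg (FirstOrder.Language.Structure.funMap (L := T.lang) (n := 0) OpSymbol.zero)
    (Subsingleton.elim _ _)

theorem realize_neg (s : OpTerm T.Un T.Bin) : s.neg.realize a = neg T X (s.realize a) :=
  congrArg (FirstOrder.Language.Structure.funMap (L := T.lang) (n := 1) OpSymbol.neg)
    (by funext i; fin_cases i; rfl)

theorem realize_add (s t : OpTerm T.Un T.Bin) :
    (s.add t).realize a = add T X (s.realize a) (t.realize a) :=
  congrArg (FirstOrder.Language.Structure.funMap (L := T.lang) (n := 2) OpSymbol.add)
    (by funext i; fin_cases i <;> rfl)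

theorem realize_un (o : T.Un) (s : OpTerm T.Un T.Bin) :
    (OpTerm.un o s).realize a = un T X o (s.realize a) :=
  congrArg (FirstOrder.Language.Structure.funMap (L := T.lang) (n := 1) (OpSymbol.unary o))
    (by funext i; fin_cases i; rfl)

theorem realize_bin (b : T.Bin) (s t : OpTerm T.Un T.Bin) :
    (OpTerm.bin b s t).realize a = bin T X b (s.realize a) (t.realize a) :=
  congrArg (FirstOrder.Language.Structure.funMap (L := T.lang) (n := 2) (OpSymbol.binary b))
    (by funext i; fin_cases i <;> rfl)

theorem realize_X (i : ℕ) : (OpTerm.X i : OpTerm T.Un T.Bin).realize a = a i := rfl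

/-- Every operation maps the constant tuple `0` to `0`. -/
theorem op_zero {n : ℕ} (s : T.lang.Functions n) :
    FirstOrder.Language.Structure.funMap s (fun _ : Fin n => zero T X) = zero T X := by
  have hid := TopGroupWithOps.identity (T := T) (X := X)
  have hassoc : ∀ x y z, add T X (add T X x y) z = add T X x (add T X y z) := by
    intro x y z
    have := hid _ T.add_assoc_mem (fun i => if i = 0 then x else if i = 1 then y else z)
    simpa [realize_add, realize_X] using this
  have hza : ∀ x, add T X (zero T X) x = x := by
    intro x
    have := hid _ T.zero_add_mem (fun _ => x)
    simpa [realize_add, realize_zero, realize_X] using this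
  have haz : ∀ x, add T X x (zero T X) = x := by
    intro x
    have := hid _ T.add_zero_mem (fun _ => x)
    simpa [realize_add, realize_zero, realize_X] using this
  have hna : ∀ x, add T X (neg T X x) x = zero T X := by
    intro x
    have := hid _ T.neg_add_mem (fun _ => x)
    simpa [realize_add, realize_neg, realize_zero, realize_X] using this
  have idem : ∀ x, add T X x x = x → x = zero T X := by
    intro x hx
    have h := hassoc (neg T X x) x x
    rw [hx, hna, hza] at h
    exact h
  have e2 : (fun _ : Fin 2 => zero T X) = ![zero T X, zero T X] := by
    funext i; fin_cases i <;> rfl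
  have e1 : (fun _ : Fin 1 => zero T X) = ![zero T X] := by
    funext i; fin_cases i; rfl
  cases s with
  | zero => exact congrArg _ (Subsingleton.elim _ _)
  | neg =>
    rw [e1]
    have h := hna (zero T X)
    rw [haz] at h
    exact h
  | add => rw [e2]; exact hza _
  | unary o =>
    rw [e1]
    apply idem
    have := hid _ (T.un_add_mem o) (fun _ => zero T X)
    simp only [realize_add, realize_un, realize_X, hza] at this
    exact this.symm
  | binary b =>
    rw [e2]
    apply idem
    have := hid _ (T.bin_add_mem b) (fun _ => zero T X)
    simp only [realize_add, realize_bin, realize_X, hza] at this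
    exact this.symm

end Zero

/-- Morphisms of topological groups with operations: continuous maps that preserve all operations
in `Ω` (the group operations included). -/
def IsMorphism (T : OpTheory.{u, v}) {X Y : Type*} [TopologicalSpace X] [TopologicalSpace Y]
    [TopGroupWithOps T X] [TopGroupWithOps T Y] (f : X → Y) : Prop :=
  Continuous f ∧ ∀ {n : ℕ} (s : T.lang.Functions n) (x : Fin n → X),
    f (FirstOrder.Language.Structure.funMap s x) = FirstOrder.Language.Structure.funMap s (fun i => f (x i))

/-! ### The fundamental group as a group with operations -/

/-- An operation of `X` as a continuous map `Xⁿ → X`. -/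
def opMap (T : OpTheory.{u, v}) (X : Type w) [TopologicalSpace X] [TopGroupWithOps T X] {n : ℕ}
    (s : T.lang.Functions n) : C(Fin n → X, X) :=
  ⟨fun x => FirstOrder.Language.Structure.funMap s x, TopGroupWithOps.continuous_op s⟩

/-- The operations on `π₁(X, 0)` induced by the pointwise operations on loops: an `n`-ary `s` sends
`[α₁], …, [αₙ]` to the class of the loop `t ↦ s (α₁ t, …, αₙ t)`. -/
noncomputable instance fundamentalGroupStructure (T : OpTheory.{u, v}) (X : Type w)
    [TopologicalSpace X] [TopGroupWithOps T X] :
    T.lang.Structure (FundamentalGroup X (zero T X)) where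
  funMap s γ := FundamentalGroup.mapOfEq (opMap T X s) (op_zero s)
    (FundamentalGroup.fromPath (Path.Homotopic.pi fun i => (γ i).toPath))
  RelMap r := r.elim

/-- A subset of an algebra for `T` is a subobject if it is (the carrier of) a subalgebra, i.e. it is
closed under all operations in `Ω`. -/
def IsSubobject (T : OpTheory.{u, v}) {M : Type w} [T.lang.Structure M] (G : Set M) : Prop :=
  ∃ S : T.lang.Substructure M, (S : Set M) = G

/-! ### Covering maps and semi-local simple connectedness -/

/-- The characteristic group `p_⋆(π₁(Y, y₀))` of a pointed continuous map `p : (Y, y₀) → (X, x₀)`. -/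
noncomputable def characteristicGroup {X Y : Type*} [TopologicalSpace X] [TopologicalSpace Y]
    (p : C(Y, X)) {y₀ : Y} {x₀ : X} (h : p y₀ = x₀) : Subgroup (FundamentalGroup X x₀) :=
  (FundamentalGroup.mapOfEq p h).range

/-- A liftable subset: open, path connected, and for each `x ∈ U` the homomorphism
`π₁(U, x) → π₁(X, x)` induced by the inclusion is trivial. -/
def IsLiftable {X : Type*} [TopologicalSpace X] (U : Set X) : Prop :=
  IsOpen U ∧ IsPathConnected U ∧
    ∀ (x : U) (γ : FundamentalGroup U x),
      FundamentalGroup.map (⟨Subtype.val, continuous_subtype_val⟩ : C(U, X)) x γ = 1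

/-- Each point has a liftable neighbourhood. -/
def IsSemiLocallySimplyConnected (X : Type*) [TopologicalSpace X] : Prop :=
  ∀ x : X, ∃ U : Set X, x ∈ U ∧ IsLiftable U

end GroupWithOps

/-! An operation `s` gives a map `Yⁿ → Xⁿ → X` that sends the constant tuple `y₀` to `0`. On `π₁` it
applies `s` to the classes `p_⋆(γᵢ)`, where `γᵢ` are the components of `γ ∈ π₁(Yⁿ)`
(`mapOfEq_opMapComp`). These classes lie in the characteristic group, and a subobject is closed
under `s`, so the lifting criterion provides a lift `Yⁿ → Y` fixing the base point
(`exists_lift_op`). The identities come from uniqueness of lifts: both sides are continuous maps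
from a connected power of `Y`, lie over the same map to `X`, and agree at the constant tuple `y₀`
(`realize_eq_of_isCoveringMap`). The group laws belong to `E`, so they need no separate argument. -/

/-- The source of a local homeomorphism to a locally path connected space is locally path
connected. -/
theorem IsLocalHomeomorph.locallyPathConnectedSpace {X Y : Type*} [TopologicalSpace X]
    [TopologicalSpace Y] [LocallyPathConnectedSpace X] {f : Y → X} (hf : IsLocalHomeomorph f) :
    LocallyPathConnectedSpace Y := by
  refine ⟨fun y ↦ ⟨fun s ↦ ⟨fun hs ↦ ?_, fun ⟨u, hu⟩ ↦ Filter.mem_of_superset hu.1.1 hu.2⟩⟩⟩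
  obtain ⟨e, hy, -⟩ := hf y
  -- The chart identifies `e.source` with the open subset `e.target` of `X`, which inherits local
  -- path connectedness.
  have : LocallyPathConnectedSpace e.source := by
    have := e.open_target.locallyPathConnectedSpace
    exact e.toHomeomorphSourceTarget.isOpenEmbedding.locallyPathConnectedSpace
  obtain ⟨u, ⟨hu, hc⟩, hus⟩ := (path_connected_basis (⟨y, hy⟩ : e.source)).mem_iff.mp
    (continuous_subtype_val.continuousAt.preimage_mem_nhds hs)
  exact ⟨Subtype.val '' u, ⟨e.open_source.isOpenMap_subtype_val.image_mem_nhds hu,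
    hc.image continuous_subtype_val⟩, Set.image_subset_iff.mpr hus⟩

/-- The lifting criterion for covering maps, with the base points of the base space related by
propositional equalities. -/
theorem IsCoveringMap.exists_lift_of_range_mapOfEq_le {A X Y : Type*} [TopologicalSpace A]
    [TopologicalSpace X] [TopologicalSpace Y] [PathConnectedSpace A] [LocallyPathConnectedSpace A]
    {p : C(Y, X)} (hp : IsCoveringMap p) {f : C(A, X)} {a₀ : A} {y₀ : Y} {x₀ : X}
    (hy : p y₀ = x₀) (ha : f a₀ = x₀)
    (le : (FundamentalGroup.mapOfEq f ha).range ≤ (FundamentalGroup.mapOfEq p hy).range) :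
    ∃ F : C(A, Y), F a₀ = y₀ ∧ p ∘ F = f := by
  -- With `x₀` replaced by `f a₀`, the cast in `mapOfEq f` becomes trivial, and only the one for `p`
  -- remains.
  subst ha
  refine (hp.existsUnique_continuousMap_lifts_of_range_le hy ?_).exists
  rintro _ ⟨γ, rfl⟩
  obtain ⟨δ, hδ⟩ := le ⟨γ, rfl⟩
  refine ⟨δ, hδ.trans ?_⟩
  rw [FundamentalGroup.mapOfEq_apply, Path.Homotopic.Quotient.cast_rfl_rfl,
    FundamentalGroup.map_apply]

namespace GroupWithOps

open FirstOrder.Language FirstOrder.Language.Structure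

universe u v

variable {T : OpTheory.{u, v}} {X Y : Type*} [TopologicalSpace X] [TopGroupWithOps T X]
  [TopologicalSpace Y]

/-- The continuous map `Yⁿ → X` obtained from a map `p : Y → X` and an `n`-ary operation of `X`. -/
def opMapComp (T : OpTheory.{u, v}) [TopGroupWithOps T X] (p : C(Y, X)) {n : ℕ}
    (s : T.lang.Functions n) : C(Fin n → Y, X) :=
  (opMap T X s).comp ⟨fun y i => p (y i), by fun_prop⟩

theorem opMapComp_const {p : C(Y, X)} {y₀ : Y} (h₀ : p y₀ = zero T X) {n : ℕ}
    (s : T.lang.Functions n) : opMapComp T p s (fun _ => y₀) = zero T X := by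
  change funMap s (fun _ : Fin n => p y₀) = _
  rw [h₀, op_zero]

/-- The homomorphism `π₁(Yⁿ) → π₁(X)` induced by an operation is the operation of `π₁(X)`, applied
to the images of the components. -/
theorem mapOfEq_opMapComp {p : C(Y, X)} {y₀ : Y} (h₀ : p y₀ = zero T X) {n : ℕ}
    (s : T.lang.Functions n) (γ : FundamentalGroup (Fin n → Y) (fun _ => y₀)) :
    FundamentalGroup.mapOfEq (opMapComp T p s) (opMapComp_const h₀ s) γ =
      funMap s (fun i : Fin n => FundamentalGroup.mapOfEq p h₀
        (FundamentalGroup.map (⟨fun y => y i, continuous_apply i⟩ : C(Fin n → Y, Y)) _ γ)) := by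
  obtain ⟨c, rfl⟩ := Path.Homotopic.Quotient.mk_surjective γ
  -- Each component class is represented by an explicit loop, so that the product of the classes is
  -- the class of the product loop (`Path.Homotopic.pi_lift`).
  have key : (fun i : Fin n => FundamentalGroup.mapOfEq p h₀
        (FundamentalGroup.map (⟨fun y => y i, continuous_apply i⟩ : C(Fin n → Y, Y)) _
          (Path.Homotopic.Quotient.mk c))) =
      fun i : Fin n => Path.Homotopic.Quotient.mk
        (((c.map (continuous_apply i)).map p.continuous).cast h₀.symm h₀.symm) := by
    funext i
    rw [FundamentalGroup.mapOfEq_apply]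
    rfl
  rw [key, FundamentalGroup.mapOfEq_apply]
  refine Eq.trans ?_ (FundamentalGroup.mapOfEq_apply (opMap T X s) (op_zero s) _).symm
  exact congrArg (fun q => (Path.Homotopic.Quotient.map q (opMap T X s)).cast
    (op_zero s).symm (op_zero s).symm) (Path.Homotopic.pi_lift fun i : Fin n =>
      ((c.map (continuous_apply i)).map p.continuous).cast h₀.symm h₀.symm).symm

/-- If the characteristic group of a covering map is a subobject, then every operation lifts. -/
theorem exists_lift_op [PathConnectedSpace Y] [LocallyPathConnectedSpace Y] {p : C(Y, X)}
    (hp : IsCoveringMap p) {y₀ : Y} (h₀ : p y₀ = zero T X)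
    (hG : IsSubobject T (characteristicGroup p h₀ : Set (FundamentalGroup X (zero T X))))
    {n : ℕ} (s : T.lang.Functions n) :
    ∃ F : C(Fin n → Y, Y), F (fun _ => y₀) = y₀ ∧ p ∘ F = opMapComp T p s := by
  refine hp.exists_lift_of_range_mapOfEq_le h₀ (opMapComp_const h₀ s) ?_
  rintro _ ⟨γ, rfl⟩
  obtain ⟨S, hS⟩ := hG
  change _ ∈ (characteristicGroup p h₀ : Set (FundamentalGroup X (zero T X)))
  rw [mapOfEq_opMapComp h₀, ← hS]
  -- The arguments of `s` lie in `S` because each is the image under `p` of a component of `γ`.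
  exact S.fun_mem s _ fun i => hS.ge ⟨_, rfl⟩

/-! ### Term functions -/

section Realize

variable {L : FirstOrder.Language} {α : Type*}

theorem continuous_realize [L.Structure Y]
    (hc : ∀ {n : ℕ} (s : L.Functions n), Continuous fun y : Fin n → Y => funMap s y)
    (t : L.Term α) : Continuous fun a : α → Y => t.realize a := by
  induction t with
  | var i => exact continuous_apply i
  | func s ts ih => exact (hc s).comp (continuous_pi ih)

theorem realize_const {M : Type*} [L.Structure M] {y₀ : M}
    (h : ∀ {n : ℕ} (s : L.Functions n), funMap s (fun _ : Fin n => y₀) = y₀)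
    (t : L.Term α) : t.realize (fun _ => y₀) = y₀ := by
  induction t with
  | var i => rfl
  | func s ts ih => rw [Term.realize_func, funext ih, h]

theorem map_realize {M N : Type*} [L.Structure M] [L.Structure N] {f : M → N}
    (h : ∀ {n : ℕ} (s : L.Functions n) (x : Fin n → M),
      f (funMap s x) = funMap s (fun i => f (x i)))
    (t : L.Term α) (a : α → M) : f (t.realize a) = t.realize (fun i => f (a i)) := by
  induction t with
  | var i => rfl
  | func s ts ih => rw [Term.realize_func, h, funext ih, Term.realize_func]

end Realize

/-- Lifts of the operations along a covering map satisfy every identity that holds below. -/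
theorem realize_eq_of_isCoveringMap [PreconnectedSpace Y] {L : FirstOrder.Language} {α : Type*}
    {Z : Type*} [TopologicalSpace Z] [L.Structure Y] [L.Structure Z] {p : Y → Z}
    (hp : IsCoveringMap p) {y₀ : Y}
    (hc : ∀ {n : ℕ} (s : L.Functions n), Continuous fun y : Fin n → Y => funMap s y)
    (h₀ : ∀ {n : ℕ} (s : L.Functions n), funMap s (fun _ : Fin n => y₀) = y₀)
    (hmap : ∀ {n : ℕ} (s : L.Functions n) (y : Fin n → Y),
      p (funMap s y) = funMap s (fun i => p (y i)))
    {t₁ t₂ : L.Term α} (ht : ∀ a : α → Z, t₁.realize a = t₂.realize a) (a : α → Y) :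
    t₁.realize a = t₂.realize a := by
  -- Both terms are viewed as maps on all of `α → Y` at once, since uniqueness of lifts needs a
  -- connected domain and a point of agreement.
  refine congrFun (hp.eq_of_comp_eq (continuous_realize hc t₁) (continuous_realize hc t₂) ?_
    (fun _ => y₀) ?_) a
  · funext b
    simp only [Function.comp_apply, map_realize hmap, ht]
  · simp only [realize_const h₀]

end GroupWithOps

theorem mainTheorem4 (T : GroupWithOps.OpTheory)
    {X : Type*} [TopologicalSpace X] [GroupWithOps.TopGroupWithOps T X]
    [ConnectedSpace X] [LocallyPathConnectedSpace X]
    (hX : GroupWithOps.IsSemiLocallySimplyConnected X)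
    {Y : Type*} [TopologicalSpace Y] [PathConnectedSpace Y]
    (p : C(Y, X)) (hp : IsCoveringMap p)
    (y₀ : Y) (h₀ : p y₀ = GroupWithOps.zero T X)
    (hG : GroupWithOps.IsSubobject T
      (GroupWithOps.characteristicGroup p h₀ :
        Set (FundamentalGroup X (GroupWithOps.zero T X)))) :
    ∃ _ : GroupWithOps.TopGroupWithOps T Y,
      GroupWithOps.zero T Y = y₀ ∧ GroupWithOps.IsMorphism T p := by
  have := hp.isLocalHomeomorph.locallyPathConnectedSpace
  choose F hF₀ hF using fun (n : ℕ) (s : T.lang.Functions n) =>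
    GroupWithOps.exists_lift_op hp h₀ hG s
  let str : T.lang.Structure Y := ⟨fun {n} s y => F n s y, fun r => r.elim⟩
  have hmap {n : ℕ} (s : T.lang.Functions n) (y : Fin n → Y) :
      p (FirstOrder.Language.Structure.funMap s y) =
        FirstOrder.Language.Structure.funMap s (fun i => p (y i)) := congrFun (hF n s) y
  refine ⟨{ str with
    continuous_op := fun {n} s => (F n s).continuous
    identity := fun e he a => GroupWithOps.realize_eq_of_isCoveringMap hp
      (fun {n} s => (F n s).continuous) (fun {n} s => hF₀ n s) hmap
      (GroupWithOps.TopGroupWithOps.identity e he) a }, ?_, p.continuous, hmap⟩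
  -- In arity `0` the empty tuple is also the constant tuple `y₀`, so base point preservation fixes
  -- the value of the constant.
  exact (congrArg (F 0 GroupWithOps.OpSymbol.zero) (Subsingleton.elim _ _)).trans (hF₀ 0 _)
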